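/- **Setting.** Formulas of $\mathsf{IPC}$ are built from denumerably many variables with $\land,\lor,\to,\lnot,0,1$. An occurrence of a variable is positive (negative) if the number of negations and antecedents of implications in whose scope it lies is even (odd); a formula is positive (negative) if all occurrences of variables in it are. A *Sahlqvist antecedent* is built from variables, negative formulas, $0$ and $1$ using only $\land,\lor$; a *Sahlqvist implication* is a positive formula, or $\lnot\varphi$, or $\varphi\to\psi$, with $\varphi$ a Sahlqvist antecedent and $\psi$ positive. A *Sahlqvist quasiequation* is an expression $$\Phi \;=\; \varphi_1\land y\le z \;\&\dots\&\; \varphi_m\land y\le z \;\Longrightarrow\; y\le z ,$$ where each $\varphi_i=\varphi_i(x_1,\dots,x_n)$ is built from Sahlqvist implications using only $\land,\lor$, and $y,z$ are distinct variables not occurring in any $\varphi_i$. A *logic* $\vdash$ is a finitary, substitution-invariant consequence relation on the set $Fm$ of formulas, over denumerably many variables, of an algebraic language. We write $\Gamma\vdash\Sigma$ if $\Gamma\vdash\sigma$ for all $\sigma\in\Sigma$. It is *protoalgebraic* if there is a nonempty finite set $\Delta(x,y)$ of formulas with $\emptyset\vdash\Delta(x,x)$ and $x,\Delta(x,y)\vdash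 y$. A set $\Gamma$ is *inconsistent* if $\Gamma\vdash\varphi$ for all $\varphi$. The logic has * the *inconsistency lemma* (IL) if for every $n\ge1$ there is a finite set $\sim_n(x_1,\dots,x_n)$ such that $\Gamma\cup\{\varphi_1,\dots,\varphi_n\}$ is inconsistent iff $\Gamma\vdash{\sim_n}(\varphi_1,\dots,\varphi_n)$; * the *deduction theorem* (DT) if for all $n,m\ge1$ there is a finite set $(x_1,\dots,x_n)\Rightarrow_{nm}(y_1,\dots,y_m)$ such that $\Gamma,\vec\varphi\vdash\vec\psi$ iff $\Gamma\vdash\vec\varphi\Rightarrow_{nm}\vec\psi$; * the *proof by cases* (PC) if for all $n,m\ge1$ there is a finite set $(x_1,\dots,x_n)\curlyvee_{nm}(y_1,\dots,y_m)$ such that ($\Gamma,\vec\varphi\vdash\gamma$ and $\Gamma,\vec\psi\vdash\gamma$) iff $\Gamma,\vec\varphi\curlyvee_{nm}\vec\psi\vdash\gamma$, each for all finite $\Gamma$ and all formulas $\vec\varphi,\vec\psi,\gamma$. $\Phi$ is *compatible* with $\vdash$ if, for each $i$: when $0$ or $\lnot$ occurs in $\varphi_i$, $\vdash$ has the IL;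 when $\to$ occurs, the DT; when $\lor$ occurs, the PC. For an algebra $A$ of the language, a *deductive filter* of $\vdash$ on $A$ is a set $F\subseteq A$ such that $\Gamma\vdash\varphi$ and $f[\Gamma]\subseteq F$ imply $f(\varphi)\in F$, for every homomorphism $f$ from the algebra of formulas to $A$. The deductive filters form a complete lattice under inclusion; its compact elements, with the join operation $+$, form a semilattice $\mathsf{Fi}^\omega_\vdash(A)$, whose meet-semilattice order is the superset relation. For the algebra of formulas it is denoted $\mathsf{Th}^\omega(\vdash)$. A formula of $\mathsf{IPC}$ is interpreted in a meet semilattice by reading $\land$ as its operation and $0,1,\lnot,\to,\lor$ as minimum, maximum, pseudocomplement, relative pseudocomplement and binary join, when these exist. The semilattice *validates* $\Phi$ if under every assignment the $\varphi_i$ can be so interpreted and the implication $\Phi$ holds. Let $\Phi$ be compatible with the protoalgebraic logic $\vdash$, fix a theorem $\top(x)$ of $\vdash$ in one variable and, for those of IL, DT, PC that $\vdash$ has, witnessing families $\sim_n$, $\Rightarrow_{nm}$, $\curlyvee_{nm}$. For $k\ge1$, put $\boldsymbol{x_i}^k=\{x_i^1,\dots,x_i^k\}$, $\boldsymbol 1^k=\{\top(x_1^1)\}$,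 $\boldsymbol 0^k=\{x_1^1\}\cup{\sim_1}(x_1^1)$, $(\boldsymbol{\psi\land\chi})^k=\boldsymbol\psi^k\cup\boldsymbol\chi^k$, and let $(\boldsymbol{\lnot\psi})^k$, $(\boldsymbol{\psi\to\chi})^k$, $(\boldsymbol{\psi\lor\chi})^k$ be obtained by applying $\sim_p$, $\Rightarrow_{pq}$, $\curlyvee_{pq}$ to enumerations of $\boldsymbol\psi^k$ and $\boldsymbol\chi^k$, where $p=|\boldsymbol\psi^k|$, $q=|\boldsymbol\chi^k|$. (If $p$ or $q$ is $0$, which can happen only when every formula is a theorem of $\vdash$, the set applied is an arbitrary finite one.) Let $\mathsf R_\vdash(\Phi)$ be the set of metarules $$\frac{\Gamma,\boldsymbol{\varphi_1}^k(\gamma_1^1,\dots,\gamma_n^k)\rhd\psi\quad\cdots\quad\Gamma,\boldsymbol{\varphi_m}^k(\gamma_1^1,\dots,\gamma_n^k)\rhd\psi}{\Gamma\rhd\psi}$$ with $k\ge1$, $\Gamma$ a finite set of formulas, and $\psi,\gamma_i^j$ formulas; $\vdash$ *validates* such a metarule if $\Gamma\vdash\psi$ whenever $\Gamma,\boldsymbol{\varphi_l}^k(\gamma_1^1,\dots,\gamma_n^k)\vdash\psi$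 for all $l\le m$. **Proposition.** Let $\Phi$ be a Sahlqvist quasiequation compatible with a protoalgebraic logic $\vdash$. Then each $\varphi_i$ has a unique value in $\mathsf{Fi}^\omega_\vdash(A)$ under every assignment, for every (nonempty) algebra $A$, and the following conditions are equivalent: 1. the logic $\vdash$ validates the metarules in $\mathsf R_\vdash(\Phi)$; 2. the semilattice $\mathsf{Th}^\omega(\vdash)$ validates $\Phi$; 3. the semilattice $\mathsf{Fi}^\omega_\vdash(A)$ validates $\Phi$, for every (nonempty) algebra $A$. -/

import Mathlib

universe u v w

namespace AAL

/-! ### Formulas of the intuitionistic propositional calculus -/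

/-- Formulas of `IPC` in the language `∧, ∨, →, ¬, 0, 1`, over the denumerable set of variables
`x₀, x₁, x₂, …`. -/
inductive IPCFormula : Type
  | var : ℕ → IPCFormula
  | and : IPCFormula → IPCFormula → IPCFormula
  | or : IPCFormula → IPCFormula → IPCFormula
  | imp : IPCFormula → IPCFormula → IPCFormula
  | neg : IPCFormula → IPCFormula
  | zero : IPCFormula
  | one : IPCFormula

namespace IPCFormula

/-- `HasOcc true x φ`: the variable `x` has a positive occurrence in `φ`;
`HasOcc false x φ`: it has a negative occurrence. The sign of an occurrence is the parity of the
number of negations and antecedents of implications within whose scope it lies. -/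
def HasOcc : Bool → ℕ → IPCFormula → Prop
  | s, x, var n => s = true ∧ x = n
  | s, x, and φ ψ => HasOcc s x φ ∨ HasOcc s x ψ
  | s, x, or φ ψ => HasOcc s x φ ∨ HasOcc s x ψ
  | s, x, imp φ ψ => HasOcc (!s) x φ ∨ HasOcc s x ψ
  | s, x, neg φ => HasOcc (!s) x φ
  | _, _, zero => False
  | _, _, one => False

/-- The variable `x` occurs in `φ`. -/
def Occurs (x : ℕ) (φ : IPCFormula) : Prop :=
  HasOcc true x φ ∨ HasOcc false x φ

/-- Every occurrence of every variable is positive. -/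
def IsPositive (φ : IPCFormula) : Prop := ∀ x, ¬ HasOcc false x φ

/-- Every occurrence of every variable is negative. -/
def IsNegative (φ : IPCFormula) : Prop := ∀ x, ¬ HasOcc true x φ

/-- Sahlqvist antecedents (without modalities): built from variables, negative formulas and the
constants using only `∧` and `∨`. -/
inductive IsSahlqvistAntecedent : IPCFormula → Prop
  | var (n : ℕ) : IsSahlqvistAntecedent (var n)
  | negative {φ : IPCFormula} : IsNegative φ → IsSahlqvistAntecedent φ
  | zero : IsSahlqvistAntecedent zero
  | one : IsSahlqvistAntecedent one
  | and {φ ψ : IPCFormula} : IsSahlqvistAntecedent φ → IsSahlqvistAntecedent ψ →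
      IsSahlqvistAntecedent (and φ ψ)
  | or {φ ψ : IPCFormula} : IsSahlqvistAntecedent φ → IsSahlqvistAntecedent ψ →
      IsSahlqvistAntecedent (or φ ψ)

/-- Sahlqvist implications (without modalities). -/
inductive IsSahlqvistImplication : IPCFormula → Prop
  | positive {φ : IPCFormula} : IsPositive φ → IsSahlqvistImplication φ
  | neg {φ : IPCFormula} : IsSahlqvistAntecedent φ → IsSahlqvistImplication (neg φ)
  | imp {φ ψ : IPCFormula} : IsSahlqvistAntecedent φ → IsPositive ψ →
      IsSahlqvistImplication (imp φ ψ)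

/-- Sahlqvist formulas: built from Sahlqvist implications using only `∧` and `∨`. -/
inductive IsSahlqvist : IPCFormula → Prop
  | implication {φ : IPCFormula} : IsSahlqvistImplication φ → IsSahlqvist φ
  | and {φ ψ : IPCFormula} : IsSahlqvist φ → IsSahlqvist ψ → IsSahlqvist (and φ ψ)
  | or {φ ψ : IPCFormula} : IsSahlqvist φ → IsSahlqvist ψ → IsSahlqvist (or φ ψ)

/-- The connective `∨` occurs in the formula. -/
def HasOr : IPCFormula → Prop
  | var _ => False
  | and φ ψ => HasOr φ ∨ HasOr ψ
  | or _ _ => True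
  | imp φ ψ => HasOr φ ∨ HasOr ψ
  | neg φ => HasOr φ
  | zero => False
  | one => False

/-- The connective `→` occurs in the formula. -/
def HasImp : IPCFormula → Prop
  | var _ => False
  | and φ ψ => HasImp φ ∨ HasImp ψ
  | or φ ψ => HasImp φ ∨ HasImp ψ
  | imp _ _ => True
  | neg φ => HasImp φ
  | zero => False
  | one => False

/-- `0` or `¬` occurs in the formula. -/
def HasZeroOrNeg : IPCFormula → Prop
  | var _ => False
  | and φ ψ => HasZeroOrNeg φ ∨ HasZeroOrNeg ψ
  | or φ ψ => HasZeroOrNeg φ ∨ HasZeroOrNeg ψ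
  | imp φ ψ => HasZeroOrNeg φ ∨ HasZeroOrNeg ψ
  | neg _ => True
  | zero => True
  | one => False

/-- `IsValue v φ a`: in the meet semilattice `S`, the formula `φ` has the value `a` under the
assignment `v` of its variables. Here `∧` is the semilattice operation, while `0`, `1`, `¬`, `→`,
`∨` are the minimum, the maximum, the pseudocomplement, the relative pseudocomplement and the join,
which are determined by the order of `S` as soon as they exist. Hence a formula has at most one
value. -/
def IsValue {S : Type w} [SemilatticeInf S] (v : ℕ → S) : IPCFormula → S → Prop
  | var n, a => a = v n
  | and φ ψ, a => ∃ b c, IsValue v φ b ∧ IsValue v ψ c ∧ a = b ⊓ c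
  | or φ ψ, a => ∃ b c, IsValue v φ b ∧ IsValue v ψ c ∧ IsLUB {b, c} a
  | imp φ ψ, a => ∃ b c, IsValue v φ b ∧ IsValue v ψ c ∧ ∀ d, d ⊓ b ≤ c ↔ d ≤ a
  | neg φ, a => ∃ b z, IsValue v φ b ∧ IsBot z ∧ ∀ d, d ⊓ b = z ↔ d ≤ a
  | zero, a => IsBot a
  | one, a => IsTop a

end IPCFormula

/-- A Sahlqvist quasiequation
`φ₁ ∧ y ≤ z & … & φₘ ∧ y ≤ z ⟹ y ≤ z`, with `y` and `z` distinct variables that do not occur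
in the Sahlqvist formulas `φ₁, …, φₘ`. -/
structure SahlqvistQuasiequation where
  /-- the number of premises -/
  m : ℕ
  /-- the formulas `φ₁, …, φₘ` -/
  φ : Fin m → IPCFormula
  /-- the variable `y` -/
  y : ℕ
  /-- the variable `z` -/
  z : ℕ
  y_ne_z : y ≠ z
  y_not_occurs : ∀ i, ¬ (φ i).Occurs y
  z_not_occurs : ∀ i, ¬ (φ i).Occurs z
  sahlqvist : ∀ i, (φ i).IsSahlqvist

/-- The semilattice `S` validates `Φ`: under every assignment `v` the formulas `φ₁, …, φₘ` have
values `a₁, …, aₘ` in `S`, and if `aᵢ ∧ v(y) ≤ v(z)` for all `i`, then `v(y) ≤ v(z)`. -/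
def SahlqvistQuasiequation.ValidIn (Φ : SahlqvistQuasiequation) (S : Type w)
    [SemilatticeInf S] : Prop :=
  ∀ v : ℕ → S, ∃ a : Fin Φ.m → S, (∀ i, (Φ.φ i).IsValue v (a i)) ∧
    ((∀ i, a i ⊓ v Φ.y ≤ v Φ.z) → v Φ.y ≤ v Φ.z)

/-! ### Logics -/

/-- A (finitary, substitution invariant) logic in the algebraic language `L`: a consequence
relation on the set `L.Term ℕ` of formulas with variables `x₀, x₁, …`. -/
structure DeductiveSystem (L : FirstOrder.Language.{u, v}) where
  /-- `Entails Γ φ` is `Γ ⊢ φ` -/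
  Entails : Set (L.Term ℕ) → L.Term ℕ → Prop
  refl : ∀ {Γ : Set (L.Term ℕ)} {φ : L.Term ℕ}, φ ∈ Γ → Entails Γ φ
  mono : ∀ {Γ Δ : Set (L.Term ℕ)} {φ : L.Term ℕ}, Γ ⊆ Δ → Entails Γ φ → Entails Δ φ
  cut : ∀ {Γ Δ : Set (L.Term ℕ)} {φ : L.Term ℕ}, (∀ ψ ∈ Δ, Entails Γ ψ) → Entails Δ φ →
    Entails Γ φ
  subst : ∀ {Γ : Set (L.Term ℕ)} {φ : L.Term ℕ} (σ : ℕ → L.Term ℕ), Entails Γ φ →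
    Entails ((fun t => t.subst σ) '' Γ) (φ.subst σ)
  finitary : ∀ {Γ : Set (L.Term ℕ)} {φ : L.Term ℕ}, Entails Γ φ →
    ∃ Δ : Set (L.Term ℕ), Δ.Finite ∧ Δ ⊆ Γ ∧ Entails Δ φ

/-- The algebra of formulas. (In an algebraic language there are no relation symbols.) -/
instance termStructure (L : FirstOrder.Language.{u, v}) (α : Type w) : L.Structure (L.Term α) where
  funMap f ts := FirstOrder.Language.Term.func f ts
  RelMap _ _ := False

namespace DeductiveSystem

variable {L : FirstOrder.Language.{u, v}}

/-- Protoalgebraic logics; the set `Δ(x, y)` is `Δ`, with `x` and `y` the variables `0` and `1`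
of `Fin 2`. -/
def IsProtoalgebraic (S : DeductiveSystem L) : Prop :=
  ∃ Δ : Finset (L.Term (Fin 2)), Δ.Nonempty ∧
    (∀ δ ∈ Δ, S.Entails ∅ (δ.subst ![FirstOrder.Language.Term.var 0, FirstOrder.Language.Term.var 0])) ∧
    S.Entails
      ({FirstOrder.Language.Term.var 0} ∪
        (fun δ : L.Term (Fin 2) =>
          δ.subst ![FirstOrder.Language.Term.var 0, FirstOrder.Language.Term.var 1]) '' (Δ : Set (L.Term (Fin 2))))
      (FirstOrder.Language.Term.var 1)

/-- A set of formulas is inconsistent if it entails every formula. -/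
def Inconsistent (S : DeductiveSystem L) (Γ : Set (L.Term ℕ)) : Prop :=
  ∀ φ, S.Entails Γ φ

/-- The finite sets `∼ₙ(x₁, …, xₙ)`, `n` positive, witness the inconsistency lemma. -/
def WitnessesIL (S : DeductiveSystem L) (neg : ∀ n : ℕ, Finset (L.Term (Fin n))) : Prop :=
  ∀ n, 0 < n → ∀ Γ : Set (L.Term ℕ), Γ.Finite → ∀ φ : Fin n → L.Term ℕ,
    S.Inconsistent (Γ ∪ Set.range φ) ↔ ∀ t ∈ neg n, S.Entails Γ (t.subst φ)

/-- The finite sets `(x₁, …, xₙ) ⇒ₙₘ (y₁, …, yₘ)`, `n` and `m` positive, witness the deduction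
theorem. -/
def WitnessesDT (S : DeductiveSystem L) (imp : ∀ n m : ℕ, Finset (L.Term (Fin n ⊕ Fin m))) :
    Prop :=
  ∀ n m, 0 < n → 0 < m → ∀ Γ : Set (L.Term ℕ), Γ.Finite →
    ∀ (φ : Fin n → L.Term ℕ) (ψ : Fin m → L.Term ℕ),
      (∀ j, S.Entails (Γ ∪ Set.range φ) (ψ j)) ↔
        ∀ t ∈ imp n m, S.Entails Γ (t.subst (Sum.elim φ ψ))

/-- The finite sets `(x₁, …, xₙ) ⋎ₙₘ (y₁, …, yₘ)`, `n` and `m` positive, witness the proof by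
cases. -/
def WitnessesPC (S : DeductiveSystem L) (or : ∀ n m : ℕ, Finset (L.Term (Fin n ⊕ Fin m))) :
    Prop :=
  ∀ n m, 0 < n → 0 < m → ∀ Γ : Set (L.Term ℕ), Γ.Finite →
    ∀ (φ : Fin n → L.Term ℕ) (ψ : Fin m → L.Term ℕ) (γ : L.Term ℕ),
      (S.Entails (Γ ∪ Set.range φ) γ ∧ S.Entails (Γ ∪ Set.range ψ) γ) ↔
        S.Entails (Γ ∪ (fun t : L.Term (Fin n ⊕ Fin m) => t.subst (Sum.elim φ ψ)) ''
          (or n m : Set (L.Term (Fin n ⊕ Fin m)))) γ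

/-- The inconsistency lemma. -/
def HasIL (S : DeductiveSystem L) : Prop := ∃ neg, S.WitnessesIL neg

/-- The deduction theorem. -/
def HasDT (S : DeductiveSystem L) : Prop := ∃ imp, S.WitnessesDT imp

/-- The proof by cases. -/
def HasPC (S : DeductiveSystem L) : Prop := ∃ or, S.WitnessesPC or

end DeductiveSystem

/-- Compatibility of a formula of `IPC` with a logic. -/
def IPCFormula.Compatible {L : FirstOrder.Language.{u, v}} (φ : IPCFormula) (S : DeductiveSystem L) : Prop :=
  (φ.HasZeroOrNeg → S.HasIL) ∧ (φ.HasImp → S.HasDT) ∧ (φ.HasOr → S.HasPC)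

/-- Compatibility of a Sahlqvist quasiequation with a logic. -/
def SahlqvistQuasiequation.Compatible {L : FirstOrder.Language.{u, v}} (Φ : SahlqvistQuasiequation)
    (S : DeductiveSystem L) : Prop :=
  ∀ i, (Φ.φ i).Compatible S

/-! ### Compact deductive filters -/

section Filters

variable {L : FirstOrder.Language.{u, v}}

/-- Deductive filters of the logic `S` on the algebra `A`. -/
structure DeductiveFilter (S : DeductiveSystem L) (A : Type w) [L.Structure A] where
  /-- the underlying set -/
  carrier : Set A
  closed : ∀ (Γ : Set (L.Term ℕ)) (φ : L.Term ℕ), S.Entails Γ φ → ∀ f : L.Hom (L.Term ℕ) A,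
    f '' Γ ⊆ carrier → f φ ∈ carrier

namespace DeductiveFilter

variable {S : DeductiveSystem L} {A : Type w} [L.Structure A]

theorem carrier_injective :
    Function.Injective (carrier : DeductiveFilter S A → Set A) := by
  rintro ⟨F, _⟩ ⟨G, _⟩ h
  cases h
  rfl

/-- Deductive filters are ordered by inclusion. -/
instance : PartialOrder (DeductiveFilter S A) := PartialOrder.lift carrier carrier_injective

/-- Intersections of deductive filters. -/
instance : InfSet (DeductiveFilter S A) where
  sInf X :=
    { carrier := ⋂ F ∈ X, carrier F
      closed := fun Γ φ h f hf => Set.mem_iInter₂.2 fun F hF =>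
        F.closed Γ φ h f (hf.trans (Set.biInter_subset_of_mem hF)) }

/-- The complete lattice of deductive filters, in which infima are intersections. -/
instance : CompleteLattice (DeductiveFilter S A) :=
  completeLatticeOfInf _ fun _ =>
    ⟨fun _ hF => Set.biInter_subset_of_mem hF, fun _ hG => Set.subset_iInter₂ fun _ hF => hG hF⟩

end DeductiveFilter

/-- The join semilattice of the compact elements of a complete lattice. -/
instance compactSemilatticeSup (B : Type w) [CompleteLattice B] :
    SemilatticeSup {a : B // IsCompactElement a} :=
  Subtype.semilatticeSup fun {x y} hx hy s u hne hdir hu hle => by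
    obtain ⟨a, ha, hxa⟩ := hx s u hne hdir hu (le_sup_left.trans hle)
    obtain ⟨b, hb, hyb⟩ := hy s u hne hdir hu (le_sup_right.trans hle)
    obtain ⟨c, hc, hac, hbc⟩ := hdir a ha b hb
    exact ⟨c, hc, sup_le (hxa.trans hac) (hyb.trans hbc)⟩

/-- The semilattice of compact deductive filters of `S` on `A`: its operation is the join
`F + G` of deductive filters, so that as a meet semilattice it is ordered under the superset
relation. -/
abbrev CompactFilters (S : DeductiveSystem L) (A : Type w) [L.Structure A] : Type w :=
  {F : DeductiveFilter S A // IsCompactElement F}ᵒᵈ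

/-- The semilattice of compact theories of `S`, i.e., of compact deductive filters on the algebra
of formulas. -/
abbrev CompactTheories (S : DeductiveSystem L) : Type u :=
  CompactFilters S (L.Term ℕ)

end Filters

/-! ### Metarules -/

section Metarules

variable {L : FirstOrder.Language.{u, v}}

/-- A choice of a theorem `⊤(x)` of the logic and of finite sets that witness the inconsistency
lemma, the deduction theorem and the proof by cases, whenever the logic has these properties. -/
structure Witnesses (S : DeductiveSystem L) where
  /-- the theorem `⊤(x)` -/
  top : L.Term (Fin 1)
  /-- the sets `∼ₙ` -/
  neg : ∀ n : ℕ, Finset (L.Term (Fin n))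
  /-- the sets `⇒ₙₘ` -/
  imp : ∀ n m : ℕ, Finset (L.Term (Fin n ⊕ Fin m))
  /-- the sets `⋎ₙₘ` -/
  or : ∀ n m : ℕ, Finset (L.Term (Fin n ⊕ Fin m))
  top_spec : S.Entails ∅ (top.subst fun _ => FirstOrder.Language.Term.var 0)
  neg_spec : S.HasIL → S.WitnessesIL neg
  imp_spec : S.HasDT → S.WitnessesDT imp
  or_spec : S.HasPC → S.WitnessesPC or

/-- An enumeration `ψ₁, …, ψₘ` (without repetitions) of a finite set, `m` its cardinality. -/
noncomputable def enum {α : Type w} (X : Finset α) : Fin X.card → α :=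
  fun i => (X.equivFin.symm i : α)

open Classical in
/-- The finite set `𝛗ᵏ` of formulas associated with the formula `φ` and the positive integer `k`.
Its variables `xᵢʲ` are the pairs `(i, j)` with `j < k`; all indices start from `0`, so that
`x₁¹` is `(0, 0)`. -/
noncomputable def IPCFormula.bold {S : DeductiveSystem L} (W : Witnesses S) (k : ℕ) :
    IPCFormula → Finset (L.Term (ℕ × ℕ))
  | .var i => (Finset.range k).image fun j => FirstOrder.Language.Term.var (i, j)
  | .one => {W.top.subst fun _ => FirstOrder.Language.Term.var (0, 0)}
  | .zero => {FirstOrder.Language.Term.var (0, 0)} ∪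
      (W.neg 1).image fun t => t.subst fun _ => FirstOrder.Language.Term.var (0, 0)
  | .and ψ χ => bold W k ψ ∪ bold W k χ
  | .neg ψ => (W.neg (bold W k ψ).card).image fun t => t.subst (enum (bold W k ψ))
  | .imp ψ χ => (W.imp (bold W k ψ).card (bold W k χ).card).image fun t =>
      t.subst (Sum.elim (enum (bold W k ψ)) (enum (bold W k χ)))
  | .or ψ χ => (W.or (bold W k ψ).card (bold W k χ).card).image fun t =>
      t.subst (Sum.elim (enum (bold W k ψ)) (enum (bold W k χ)))

/-- A metarule: from the sequents `Γ ▷ ψ` in `premises` infer the sequent `conclusion`. -/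
structure Metarule (L : FirstOrder.Language.{u, v}) where
  /-- the premises -/
  premises : Set (Set (L.Term ℕ) × L.Term ℕ)
  /-- the conclusion -/
  conclusion : Set (L.Term ℕ) × L.Term ℕ

/-- The logic `S` validates the metarule `r`. -/
def DeductiveSystem.Validates (S : DeductiveSystem L) (r : Metarule L) : Prop :=
  (∀ s ∈ r.premises, S.Entails s.1 s.2) → S.Entails r.conclusion.1 r.conclusion.2

/-- The set of metarules associated with `Φ`: for every positive integer `k`, finite `Γ`,
formula `ψ` and formulas `γᵢʲ`, the metarule with premises `Γ, 𝛗ₗᵏ(γ) ▷ ψ` for `l = 1, …, m` and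
conclusion `Γ ▷ ψ`. -/
def SahlqvistQuasiequation.metarules (Φ : SahlqvistQuasiequation) {S : DeductiveSystem L}
    (W : Witnesses S) : Set (Metarule L) :=
  {r | ∃ (k : ℕ) (Γ : Set (L.Term ℕ)) (ψ : L.Term ℕ) (γ : ℕ × ℕ → L.Term ℕ),
    0 < k ∧ Γ.Finite ∧
    r.premises = Set.range (fun l : Fin Φ.m =>
      (Γ ∪ (fun t : L.Term (ℕ × ℕ) => t.subst γ) ''
        ((Φ.φ l).bold W k : Set (L.Term (ℕ × ℕ))), ψ)) ∧
    r.conclusion = (Γ, ψ)}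

end Metarules

end AAL

/-! The inconsistency lemma, the deduction theorem and the proof by cases speak of formulas only;
the point is to transfer them to compact filters on an arbitrary algebra `A`. The bridge is
`realize_mem_generate_iff`. Work with terms whose variables are the elements of `A`. The value of
`φ` lies in the filter generated by the values of a finite `Γ` iff some finite set `T` of terms with
value in the least filter satisfies `T, Γ ⊢ φ` under every substitution `ρ : A → L.Term ℕ`.
Protoalgebraicity enters here: if `φ` and `ψ` have the same value, then the terms `Δ(φ, ψ)` take the
values of `Δ(x, x)`, so they belong to the kernel and may be put into `T` to pass from `φ` to `ψ`.

Since `T` is finite and independent of `ρ`, each metatheorem can be applied for one `ρ` at a time,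
with the image of `T` in the side premises. Hence the witnessing sets, evaluated in `A`, generate
the pseudocomplements, relative pseudocomplements and joins (intersections of filters) of compact
filters. By induction the value of `φ` is the filter generated by the values of `𝛗ᵏ`
(`isValue_generateCompact`); this gives existence, while uniqueness is order-theoretic.

From the metarules to validity in `A`: the premises of the quasiequation become finitely many
entailments with one common `T`, and each `ρ` turns them into the premises of an instance of a
metarule. Conversely, on the algebra of formulas generated filters are theories, and a metarule is
the quasiequation under a suitable assignment. -/

namespace AAL

open FirstOrder.Language (Term)

/-! ### Evaluation, substitution and renaming of terms. -/

section TermEvaluation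

variable {L : FirstOrder.Language.{u, v}} {A : Type w} [L.Structure A] {α β : Type*}

/-- Evaluation of terms as a homomorphism. -/
def evalHom (f : α → A) : L.Hom (L.Term α) A where
  toFun t := t.realize f
  map_fun' _ _ := rfl
  map_rel' _ _ h := h.elim

theorem hom_eq_realize (f : L.Hom (L.Term α) A) (t : L.Term α) :
    f t = t.realize fun n => f (Term.var n) := by
  induction t with
  | var n => rfl
  | func g ts ih =>
    rw [FirstOrder.Language.Term.realize_func, ← funext ih]
    exact f.map_fun' g ts

theorem realize_term_eq_subst (f : α → L.Term β) (t : L.Term α) : t.realize f = t.subst f := by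
  induction t with
  | var n => rfl
  | func g ts ih =>
    rw [FirstOrder.Language.Term.realize_func, funext ih]
    rfl

theorem subst_subst {γ : Type*} (t : L.Term α) (f : α → L.Term β) (g : β → L.Term γ) :
    (t.subst f).subst g = t.subst fun a => (f a).subst g := by
  simp only [← realize_term_eq_subst g, FirstOrder.Language.Term.realize_subst]
  rw [← realize_term_eq_subst]

open Classical in
theorem realize_congr_of_eqOn_varFinset (t : L.Term α) {f g : α → A}
    (h : ∀ a ∈ t.varFinset, f a = g a) : t.realize f = t.realize g := by
  induction t with
  | var n => exact h n (by simp [FirstOrder.Language.Term.varFinset])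
  | func F ts ih =>
    simp only [FirstOrder.Language.Term.realize_func]
    congr 1
    funext i
    refine ih i fun a ha => h a ?_
    simp only [FirstOrder.Language.Term.varFinset, Finset.mem_biUnion, Finset.mem_univ, true_and]
    exact ⟨i, ha⟩

/-- Finitely many variables can be renamed injectively into `ℕ`. -/
theorem exists_renaming [Nonempty α] (V : Finset α) :
    ∃ (r : α → ℕ) (s : ℕ → α), ∀ a ∈ V, s (r a) = a := by
  classical
  obtain ⟨e⟩ : Nonempty (V ≃ Fin V.card) := ⟨V.equivFin⟩
  refine ⟨fun a => if h : a ∈ V then e ⟨a, h⟩ else 0,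
    fun n => if h : n < V.card then e.symm ⟨n, h⟩ else Classical.arbitrary α, fun a ha => ?_⟩
  simp [ha]

end TermEvaluation

/-! ### Generated filters; the compact filters are the finitely generated ones. -/

namespace DeductiveFilter

variable {L : FirstOrder.Language.{u, v}} {A : Type w} [L.Structure A] {S : DeductiveSystem L}

theorem realize_mem (F : DeductiveFilter S A) {Γ : Set (L.Term ℕ)} {φ : L.Term ℕ}
    (h : S.Entails Γ φ) (f : ℕ → A) (hf : ∀ t ∈ Γ, t.realize f ∈ F.carrier) :
    φ.realize f ∈ F.carrier :=
  F.closed Γ φ h (evalHom f) (by rintro _ ⟨t, ht, rfl⟩; exact hf t ht)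

/-- A set that is closed under the entailments with finitely many premises is a filter. -/
def ofFinite (C : Set A)
    (hC : ∀ (Γ : Set (L.Term ℕ)) (φ : L.Term ℕ), Γ.Finite → S.Entails Γ φ → ∀ f : ℕ → A,
      (∀ t ∈ Γ, t.realize f ∈ C) → φ.realize f ∈ C) : DeductiveFilter S A where
  carrier := C
  closed Γ φ h f hf := by
    obtain ⟨Δ, hfin, hsub, hΔ⟩ := S.finitary h
    rw [hom_eq_realize]
    refine hC Δ φ hfin hΔ _ fun t ht => ?_
    rw [← hom_eq_realize]
    exact hf ⟨t, hsub ht, rfl⟩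

variable (S) in
/-- The deductive filter generated by a set. -/
def generate (C : Set A) : DeductiveFilter S A := sInf {F | C ⊆ F.carrier}

theorem generate_le_iff {C : Set A} {F : DeductiveFilter S A} :
    generate S C ≤ F ↔ C ⊆ F.carrier := by
  constructor
  · intro h
    have hC : C ⊆ (generate S C).carrier := Set.subset_iInter₂ fun G hG => hG
    exact hC.trans h
  · intro h
    exact sInf_le h

theorem subset_generate (C : Set A) : C ⊆ (generate S C).carrier := generate_le_iff.1 le_rfl

theorem generate_mono {C D : Set A} (h : C ⊆ D) : generate S C ≤ generate S D :=
  generate_le_iff.2 (h.trans (subset_generate D))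

theorem generate_sup_generate (C D : Set A) :
    generate S C ⊔ generate S D = generate S (C ∪ D) := by
  refine le_antisymm (sup_le (generate_mono Set.subset_union_left)
    (generate_mono Set.subset_union_right)) (generate_le_iff.2 (Set.union_subset ?_ ?_))
  · exact generate_le_iff.1 le_sup_left
  · exact generate_le_iff.1 le_sup_right

/-- The union of a nonempty directed set of filters. -/
def directedUnion (X : Set (DeductiveFilter S A)) (hne : X.Nonempty)
    (hdir : DirectedOn (· ≤ ·) X) : DeductiveFilter S A :=
  ofFinite (⋃ F ∈ X, F.carrier) <| by
    intro Γ φ hfin h f hf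
    have key : ∃ F ∈ X, ∀ t ∈ Γ, t.realize f ∈ F.carrier := by
      clear h
      induction Γ, hfin using Set.Finite.induction_on with
      | empty => exact ⟨hne.some, hne.some_mem, by simp⟩
      | @insert a s _ _ ih =>
        obtain ⟨F, hF, hFs⟩ := ih fun t ht => hf t (Set.mem_insert_of_mem _ ht)
        obtain ⟨G, hG, hGa⟩ := Set.mem_iUnion₂.1 (hf a (Set.mem_insert _ _))
        obtain ⟨H, hH, hFH, hGH⟩ := hdir F hF G hG
        refine ⟨H, hH, ?_⟩
        rintro t (rfl | ht)
        · exact hGH hGa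
        · exact hFH (hFs t ht)
    obtain ⟨F, hF, hFΓ⟩ := key
    exact Set.mem_iUnion₂.2 ⟨F, hF, F.realize_mem h f hFΓ⟩

/-- By finitarity, directed suprema of filters are unions, and a finite subset of a directed union
lies in one member. -/
theorem isCompactElement_generate {C : Set A} (hC : C.Finite) :
    IsCompactElement (generate S C) := by
  intro X U hne hdir hU hle
  have hUle : U ≤ directedUnion X hne hdir := hU.2 fun F hF => Set.subset_biUnion_of_mem hF
  have hsub : C ⊆ ⋃ F ∈ X, F.carrier := generate_le_iff.1 (hle.trans hUle)
  have key : ∃ F ∈ X, C ⊆ F.carrier := by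
    clear hle
    induction C, hC using Set.Finite.induction_on with
    | empty => exact ⟨hne.some, hne.some_mem, by simp⟩
    | @insert a s _ _ ih =>
      obtain ⟨F, hF, hFs⟩ := ih ((Set.subset_insert a s).trans hsub)
      obtain ⟨G, hG, hGa⟩ := Set.mem_iUnion₂.1 (hsub (Set.mem_insert _ _))
      obtain ⟨H, hH, hFH, hGH⟩ := hdir F hF G hG
      exact ⟨H, hH, Set.insert_subset (hGH hGa) (hFs.trans hFH)⟩
  obtain ⟨F, hF, hCF⟩ := key
  exact ⟨F, hF, generate_le_iff.2 hCF⟩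

/-- A filter is the directed supremum of the filters generated by its finite subsets, so a compact
one is below, hence equal to, one of these. -/
theorem exists_finite_generate {F : DeductiveFilter S A} (hF : IsCompactElement F) :
    ∃ C : Set A, C.Finite ∧ F = generate S C := by
  obtain ⟨G, ⟨C, ⟨hC, hCF⟩, rfl⟩, hle⟩ := hF
    (generate S '' {C : Set A | C.Finite ∧ C ⊆ F.carrier}) F
    ⟨_, ∅, ⟨Set.finite_empty, Set.empty_subset _⟩, rfl⟩
    (by
      rintro _ ⟨C, ⟨hC, hCF⟩, rfl⟩ _ ⟨D, ⟨hD, hDF⟩, rfl⟩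
      exact ⟨_, ⟨C ∪ D, ⟨hC.union hD, Set.union_subset hCF hDF⟩, rfl⟩,
        generate_mono Set.subset_union_left, generate_mono Set.subset_union_right⟩)
    (by
      constructor
      · rintro _ ⟨C, ⟨_, hCF⟩, rfl⟩
        exact generate_le_iff.2 hCF
      · intro G hG a ha
        exact generate_le_iff.1 (hG ⟨{a}, ⟨Set.finite_singleton a, by simpa using ha⟩, rfl⟩)
          (Set.mem_singleton a))
    le_rfl
  exact ⟨C, hC, le_antisymm hle (generate_le_iff.2 hCF)⟩

end DeductiveFilter

/-! ### Filter generation as entailment modulo the kernel. -/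

namespace DeductiveSystem

open DeductiveFilter

variable {L : FirstOrder.Language.{u, v}} {A : Type w} {S : DeductiveSystem L}

/-- Entailment between terms with variables in `A`, under every substitution of formulas. -/
def UniformlyEntails (S : DeductiveSystem L) (Γ : Set (L.Term A)) (φ : L.Term A) : Prop :=
  ∀ ρ : A → L.Term ℕ, S.Entails ((fun t => t.subst ρ) '' Γ) (φ.subst ρ)

theorem UniformlyEntails.mono {Γ Δ : Set (L.Term A)} {φ : L.Term A} (h : Γ ⊆ Δ)
    (hφ : S.UniformlyEntails Γ φ) : S.UniformlyEntails Δ φ :=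
  fun ρ => S.mono (Set.image_mono h) (hφ ρ)

theorem UniformlyEntails.cut {Γ Δ : Set (L.Term A)} {φ : L.Term A}
    (h : ∀ ψ ∈ Δ, S.UniformlyEntails Γ ψ) (hφ : S.UniformlyEntails Δ φ) :
    S.UniformlyEntails Γ φ :=
  fun ρ => S.cut (by rintro _ ⟨ψ, hψ, rfl⟩; exact h ψ hψ ρ) (hφ ρ)

theorem UniformlyEntails.refl {Γ : Set (L.Term A)} {φ : L.Term A} (h : φ ∈ Γ) :
    S.UniformlyEntails Γ φ :=
  fun _ => S.refl ⟨φ, h, rfl⟩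

/-- Entailments are preserved by substitutions of terms over `A`. -/
theorem Entails.uniformlyEntails {Γ : Set (L.Term ℕ)} {φ : L.Term ℕ} (h : S.Entails Γ φ)
    (σ : ℕ → L.Term A) : S.UniformlyEntails ((fun t => t.subst σ) '' Γ) (φ.subst σ) := by
  intro ρ
  have := S.subst (fun n => (σ n).subst ρ) h
  rw [Set.image_image, subst_subst]
  simpa only [subst_subst] using this

/-- Only finitely many elements of `A` occur as variables. Renaming them injectively into `ℕ` gives
an honest entailment of the logic, and the assignment that undoes the renaming recovers the original
values. -/
theorem UniformlyEntails.realize_mem [L.Structure A] [Nonempty A] {Γ : Set (L.Term A)}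
    {φ : L.Term A} (hΓ : Γ.Finite)
    (h : S.UniformlyEntails Γ φ) (F : DeductiveFilter S A)
    (hF : ∀ t ∈ Γ, t.realize id ∈ F.carrier) : φ.realize id ∈ F.carrier := by
  classical
  obtain ⟨r, s, hrs⟩ := exists_renaming
    (φ.varFinset ∪ hΓ.toFinset.biUnion fun t => t.varFinset)
  have key : ∀ t : L.Term A,
      t.varFinset ⊆ φ.varFinset ∪ hΓ.toFinset.biUnion (fun t => t.varFinset) →
      (t.subst fun a => Term.var (r a)).realize s = t.realize id := by
    intro t ht
    rw [FirstOrder.Language.Term.realize_subst]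
    exact realize_congr_of_eqOn_varFinset t fun a ha => hrs a (ht ha)
  have := F.realize_mem (h fun a => Term.var (r a)) s (by
    rintro _ ⟨t, ht, rfl⟩
    rw [key t ((Finset.subset_biUnion_of_mem (fun t : L.Term A => t.varFinset)
      (hΓ.mem_toFinset.2 ht)).trans Finset.subset_union_right)]
    exact hF t ht)
  rwa [key φ Finset.subset_union_left] at this

variable [L.Structure A]

/-- The terms over `A` whose value belongs to the least deductive filter of `A`. -/
def kernel (S : DeductiveSystem L) (A : Type w) [L.Structure A] : Set (L.Term A) := {t | t.realize id ∈ (generate S (∅ : Set A)).carrier}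

/-- Uniform entailment modulo finitely many terms of the kernel. -/
def KernelEntails (S : DeductiveSystem L) (Γ : Set (L.Term A)) (φ : L.Term A) : Prop :=
  ∃ T ⊆ kernel S A, T.Finite ∧ S.UniformlyEntails (T ∪ Γ) φ

/-- A common finite part of the kernel for finitely many conclusions. -/
theorem exists_common_kernel {ι : Type*} {I : Set ι} (hI : I.Finite) {Γ : ι → Set (L.Term A)}
    {φ : ι → L.Term A} (h : ∀ i ∈ I, S.KernelEntails (Γ i) (φ i)) :
    ∃ T ⊆ kernel S A, T.Finite ∧ ∀ i ∈ I, S.UniformlyEntails (T ∪ Γ i) (φ i) := by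
  choose! T hT hfin hφ using h
  refine ⟨⋃ i ∈ I, T i, Set.iUnion₂_subset hT, hI.biUnion hfin, fun i hi => ?_⟩
  exact (hφ i hi).mono (Set.union_subset_union_left _ (Set.subset_biUnion_of_mem hi))

/-- This is where protoalgebraicity is needed: modulo the kernel, entailment of a term depends only
on its value in `A`. -/
theorem KernelEntails.of_realize_eq (hS : S.IsProtoalgebraic) {Γ : Set (L.Term A)}
    {φ ψ : L.Term A} (h : S.KernelEntails Γ φ) (heq : φ.realize id = ψ.realize id) :
    S.KernelEntails Γ ψ := by
  obtain ⟨T, hT, hfin, hφ⟩ := h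
  obtain ⟨Δ, -, hrefl, hmp⟩ := hS
  -- The terms `Δ(φ, ψ)` have the values of the theorems `Δ(x, x)`, so they lie in every filter.
  let D : Set (L.Term A) := (fun δ : L.Term (Fin 2) => δ.subst ![φ, ψ]) '' (Δ : Set _)
  have hD : D ⊆ kernel S A := by
    rintro _ ⟨δ, hδ, rfl⟩
    have := (generate S (∅ : Set A)).realize_mem (hrefl δ hδ) (fun _ => φ.realize id) (by simp)
    rw [FirstOrder.Language.Term.realize_subst] at this
    change (δ.subst ![φ, ψ]).realize id ∈ (generate S (∅ : Set A)).carrier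
    rw [FirstOrder.Language.Term.realize_subst]
    convert this using 2
    funext i
    fin_cases i
    · rfl
    · exact heq.symm
  refine ⟨T ∪ D, Set.union_subset hT hD, hfin.union (Δ.finite_toSet.image _), ?_⟩
  have h2 := hmp.uniformlyEntails (fun n => if n = 0 then φ else ψ)
  refine UniformlyEntails.cut ?_ h2
  rintro _ ⟨_, rfl | ⟨δ, hδ, rfl⟩, rfl⟩
  · exact hφ.mono (Set.union_subset_union_left _ Set.subset_union_left)
  · refine UniformlyEntails.refl (Or.inl (Or.inr ⟨δ, hδ, ?_⟩))
    dsimp only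
    rw [subst_subst]
    congr 1
    funext i
    fin_cases i <;> rfl

/-- Generated filters are described by entailment modulo the kernel. -/
theorem realize_mem_generate_iff [Nonempty A] (hS : S.IsProtoalgebraic) {Γ : Set (L.Term A)}
    (hΓ : Γ.Finite) (φ : L.Term A) :
    φ.realize id ∈ (generate S ((fun t : L.Term A => t.realize id) '' Γ)).carrier ↔
      S.KernelEntails Γ φ := by
  constructor
  -- The elements entailed modulo the kernel form a filter containing the generators, hence
  -- containing the generated filter.
  · let G : DeductiveFilter S A := ofFinite {a | S.KernelEntails Γ (Term.var a)} <| by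
      intro Δ δ hfin h f hf
      have hf' : ∀ t ∈ Δ, S.KernelEntails Γ (t.subst fun n => Term.var (f n)) := fun t ht =>
        KernelEntails.of_realize_eq hS (hf t ht) (by
          rw [FirstOrder.Language.Term.realize_subst]; rfl)
      obtain ⟨T, hT, hTfin, hTΔ⟩ := exists_common_kernel hfin hf'
      refine KernelEntails.of_realize_eq (φ := δ.subst fun n => Term.var (f n)) hS
        ⟨T, hT, hTfin, ?_⟩ (by rw [FirstOrder.Language.Term.realize_subst]; rfl)
      refine UniformlyEntails.cut ?_ (h.uniformlyEntails fun n => Term.var (f n))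
      rintro _ ⟨t, ht, rfl⟩
      exact hTΔ t ht
    have hle : generate S ((fun t : L.Term A => t.realize id) '' Γ) ≤ G := by
      rw [generate_le_iff]
      rintro _ ⟨t, ht, rfl⟩
      exact KernelEntails.of_realize_eq (φ := t) hS
        ⟨∅, Set.empty_subset _, Set.finite_empty, UniformlyEntails.refl (Or.inr ht)⟩ rfl
    intro h
    exact KernelEntails.of_realize_eq (φ := Term.var (φ.realize id)) hS (hle h) rfl
  · rintro ⟨T, hT, hfin, h⟩
    refine h.realize_mem (hfin.union hΓ) _ ?_
    rintro t (ht | ht)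
    · exact generate_mono (Set.empty_subset _) (hT ht)
    · exact subset_generate _ ⟨t, ht, rfl⟩

end DeductiveSystem
end AAL

/-! ### Transfer of the three metatheorems to filters on arbitrary algebras. -/

namespace AAL
open FirstOrder.Language (Term)
namespace DeductiveSystem

open DeductiveFilter

variable {L : FirstOrder.Language.{u, v}} {A : Type w} {S : DeductiveSystem L}

section

variable [L.Structure A] [Nonempty A]

/-- Generated filters in terms of entailments between terms, for finitely many conclusions. -/
theorem forall_realize_mem_generate_iff (hS : S.IsProtoalgebraic) {D : Set A} (hD : D.Finite)
    {I : Set (L.Term A)} (hI : I.Finite) :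
    (∀ t ∈ I, t.realize id ∈ (generate S D).carrier) ↔
      ∃ T ⊆ kernel S A, T.Finite ∧ ∀ t ∈ I, S.UniformlyEntails (T ∪ Term.var '' D) t := by
  have hD' : D = (fun t : L.Term A => t.realize id) '' (Term.var '' D) := by
    rw [Set.image_image]; simp
  have hmem : ∀ t : L.Term A, t.realize id ∈ (generate S D).carrier ↔
      S.KernelEntails (Term.var '' D) t := by
    intro t
    rw [← realize_mem_generate_iff hS (hD.image _), ← hD']
  constructor
  · intro h
    exact exists_common_kernel (φ := fun t => t) hI fun t ht => (hmem t).1 (h t ht)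
  · rintro ⟨T, hT, hfin, h⟩ t ht
    exact (hmem t).2 ⟨T, hT, hfin, h t ht⟩

end

/-- The inconsistency lemma applied to the trivial entailment of `∼₁(φ)` from itself. -/
theorem WitnessesIL.inconsistent_var {neg : ∀ n : ℕ, Finset (L.Term (Fin n))}
    (h : S.WitnessesIL neg) (φ : L.Term ℕ) :
    S.Inconsistent ((fun t : L.Term (Fin 1) => t.subst fun _ => φ) '' (neg 1 : Set _) ∪ {φ}) := by
  have := (h 1 one_pos ((fun t : L.Term (Fin 1) => t.subst fun _ => φ) '' (neg 1 : Set _))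
    ((neg 1).finite_toSet.image _) fun _ => φ).2 fun t ht => S.refl ⟨t, ht, rfl⟩
  simpa using this

variable [L.Structure A]

/-- The improper filter is generated by `{x} ∪ ∼(x)`. -/
theorem WitnessesIL.generate_eq_univ {neg : ∀ n : ℕ, Finset (L.Term (Fin n))}
    (h : S.WitnessesIL neg) (a : A) :
    (generate S ({a} ∪ (fun t : L.Term (Fin 1) => t.realize fun _ => a) '' (neg 1 : Set _))
      ).carrier = Set.univ := by
  refine Set.eq_univ_of_forall fun b => ?_
  have := (generate S ({a} ∪ (fun t : L.Term (Fin 1) => t.realize fun _ => a) ''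
      (neg 1 : Set _))).realize_mem (h.inconsistent_var (Term.var 0) (Term.var 1))
      (fun n => if n = 0 then a else b) ?_
  · simpa using this
  · rintro _ (⟨t, ht, rfl⟩ | rfl)
    · refine subset_generate _ (Or.inr ⟨t, ht, ?_⟩)
      simp [FirstOrder.Language.Term.realize_subst]
    · exact subset_generate _ (Or.inl (by simp))

variable [Nonempty A]

/-- The inconsistency lemma with a finite set of side premises, transferred to `A`. -/
theorem WitnessesIL.generate_eq_univ_iff (hS : S.IsProtoalgebraic)
    {neg : ∀ n : ℕ, Finset (L.Term (Fin n))}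
    (h : S.WitnessesIL neg) {n : ℕ} (hn : 0 < n) {D : Set A} (hD : D.Finite) (b : Fin n → A) :
    (generate S (D ∪ Set.range b)).carrier = Set.univ ↔
      ∀ t ∈ neg n, t.realize b ∈ (generate S D).carrier := by
  have hI : ((fun t : L.Term (Fin n) => t.subst fun i => Term.var (b i)) ''
    (neg n : Set _)).Finite := (neg n).finite_toSet.image _
  have hrhs : (∀ t ∈ neg n, t.realize b ∈ (generate S D).carrier) ↔
      ∀ t ∈ (fun t : L.Term (Fin n) => t.subst fun i => Term.var (b i)) '' (neg n : Set _),
        t.realize id ∈ (generate S D).carrier := by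
    simp [FirstOrder.Language.Term.realize_subst]
  rw [hrhs, forall_realize_mem_generate_iff hS hD hI]
  have himage : ∀ (T : Set (L.Term A)) (ρ : A → L.Term ℕ),
      (fun t : L.Term A => t.subst ρ) '' (T ∪ Term.var '' (D ∪ Set.range b)) =
        (fun t : L.Term A => t.subst ρ) '' (T ∪ Term.var '' D) ∪
          Set.range fun i => ρ (b i) := by
    intro T ρ
    simp only [Set.image_union, Set.union_assoc, ← Set.range_comp]
    rfl
  have hU : (D ∪ Set.range b).Finite := hD.union (Set.finite_range b)
  constructor
  · intro huniv
    -- Inconsistency concerns infinitely many conclusions, whereas a common `T` exists only for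
    -- finitely many. The finite inconsistent set `{a} ∪ ∼₁(a)` stands in for all of them.
    let a : A := Classical.arbitrary A
    have hJ : ({Term.var a} ∪ (fun t : L.Term (Fin 1) => t.subst fun _ => Term.var a) ''
        (neg 1 : Set _) : Set (L.Term A)).Finite :=
      (Set.finite_singleton _).union ((neg 1).finite_toSet.image _)
    obtain ⟨T, hT, hfin, hφ⟩ := (forall_realize_mem_generate_iff hS hU hJ).1
      fun t _ => by rw [huniv]; trivial
    refine ⟨T, hT, hfin, ?_⟩
    rintro _ ⟨t, ht, rfl⟩ ρ
    have := (h n hn ((fun t : L.Term A => t.subst ρ) '' (T ∪ Term.var '' D))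
      ((hfin.union (hD.image _)).image _) fun i => ρ (b i)).1 ?_ t ht
    · rw [subst_subst]; exact this
    · rw [← himage]
      refine fun ψ => S.cut ?_ (h.inconsistent_var (ρ a) ψ)
      rintro _ (⟨t, ht, rfl⟩ | rfl)
      · have := hφ (t.subst fun _ => Term.var a) (Or.inr ⟨t, ht, rfl⟩) ρ
        rwa [subst_subst] at this
      · exact hφ (Term.var a) (Or.inl rfl) ρ
  · rintro ⟨T, hT, hfin, hφ⟩
    refine Set.eq_univ_of_forall fun c => ?_
    refine (forall_realize_mem_generate_iff hS hU (Set.finite_singleton (Term.var c))).2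
      ⟨T, hT, hfin, ?_⟩ _ rfl
    rintro _ rfl ρ
    rw [himage]
    refine (h n hn _ ((hfin.union (hD.image _)).image _) fun i => ρ (b i)).2 (fun t ht => ?_) _
    have := hφ _ ⟨t, ht, rfl⟩ ρ
    rwa [subst_subst] at this

theorem WitnessesDT.mem_generate_iff (hS : S.IsProtoalgebraic)
    {imp : ∀ n m : ℕ, Finset (L.Term (Fin n ⊕ Fin m))}
    (h : S.WitnessesDT imp) {n m : ℕ} (hn : 0 < n) (hm : 0 < m) {D : Set A} (hD : D.Finite)
    (b : Fin n → A) (c : Fin m → A) :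
    (∀ j, c j ∈ (generate S (D ∪ Set.range b)).carrier) ↔
      ∀ t ∈ imp n m, t.realize (Sum.elim b c) ∈ (generate S D).carrier := by
  have hI : ((fun t : L.Term (Fin n ⊕ Fin m) => t.subst fun i => Term.var (Sum.elim b c i)) ''
    (imp n m : Set _)).Finite := (imp n m).finite_toSet.image _
  have hrhs : (∀ t ∈ imp n m, t.realize (Sum.elim b c) ∈ (generate S D).carrier) ↔
      ∀ t ∈ (fun t : L.Term (Fin n ⊕ Fin m) => t.subst fun i => Term.var (Sum.elim b c i)) ''
        (imp n m : Set _), t.realize id ∈ (generate S D).carrier := by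
    simp [FirstOrder.Language.Term.realize_subst]
  have hlhs : (∀ j, c j ∈ (generate S (D ∪ Set.range b)).carrier) ↔
      ∀ t ∈ Set.range fun j => (Term.var (c j) : L.Term A),
        t.realize id ∈ (generate S (D ∪ Set.range b)).carrier := by
    simp
  rw [hrhs, hlhs, forall_realize_mem_generate_iff hS hD hI,
    forall_realize_mem_generate_iff hS (hD.union (Set.finite_range b)) (Set.finite_range _)]
  -- The same `T` serves both sides; for each `ρ` the deduction theorem is applied with the images
  -- of `T` and `D` as side premises.
  refine exists_congr fun T => and_congr_right fun hT => and_congr_right fun hfin => ?_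
  have himage : ∀ ρ : A → L.Term ℕ,
      (fun t : L.Term A => t.subst ρ) '' (T ∪ Term.var '' (D ∪ Set.range b)) =
        (fun t : L.Term A => t.subst ρ) '' (T ∪ Term.var '' D) ∪
          Set.range fun i => ρ (b i) := by
    intro ρ
    simp only [Set.image_union, Set.union_assoc, ← Set.range_comp]
    rfl
  have key : ∀ ρ : A → L.Term ℕ, _ := fun ρ => h n m hn hm
    ((fun t : L.Term A => t.subst ρ) '' (T ∪ Term.var '' D))
      ((hfin.union (hD.image _)).image _) (fun i => ρ (b i)) (fun j => ρ (c j))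
  have helim : ∀ (ρ : A → L.Term ℕ) (t : L.Term (Fin n ⊕ Fin m)),
      (t.subst fun i => Term.var (Sum.elim b c i)).subst ρ =
        t.subst (Sum.elim (fun i => ρ (b i)) fun j => ρ (c j)) := by
    intro ρ t
    rw [subst_subst]
    congr 1
    funext i
    cases i <;> rfl
  constructor
  · rintro hφ _ ⟨t, ht, rfl⟩ ρ
    have := (key ρ).1 (fun j => ?_) t ht
    · rwa [helim]
    · rw [← himage]; exact hφ _ ⟨j, rfl⟩ ρ
  · rintro hφ _ ⟨j, rfl⟩ ρ
    rw [himage]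
    refine (key ρ).2 (fun t ht => ?_) j
    rw [← helim]
    exact hφ _ ⟨t, ht, rfl⟩ ρ

/-- Joins in the superset order should be intersections, but an intersection of compact filters need
not be compact in general; here the proof by cases supplies finitely many generators. -/
theorem WitnessesPC.generate_inter (hS : S.IsProtoalgebraic)
    {or : ∀ n m : ℕ, Finset (L.Term (Fin n ⊕ Fin m))}
    (h : S.WitnessesPC or) {n m : ℕ} (hn : 0 < n) (hm : 0 < m)
    (b : Fin n → A) (c : Fin m → A) :
    (generate S (Set.range b)).carrier ∩ (generate S (Set.range c)).carrier =
      (generate S ((fun t : L.Term (Fin n ⊕ Fin m) => t.realize (Sum.elim b c)) ''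
        (or n m : Set _))).carrier := by
  have hvar : ∀ (T : Set (L.Term A)) {p : ℕ} (d : Fin p → A) (ρ : A → L.Term ℕ),
      (fun t : L.Term A => t.subst ρ) '' (T ∪ Term.var '' Set.range d) =
        (fun t : L.Term A => t.subst ρ) '' T ∪ Set.range fun i => ρ (d i) := by
    intro T p d ρ
    simp only [Set.image_union, ← Set.range_comp]
    rfl
  have helim : ∀ (ρ : A → L.Term ℕ) (t : L.Term (Fin n ⊕ Fin m)),
      (t.subst fun i => Term.var (Sum.elim b c i)).subst ρ =
        t.subst (Sum.elim (fun i => ρ (b i)) fun j => ρ (c j)) := by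
    intro ρ t
    rw [subst_subst]
    congr 1
    funext i
    cases i <;> rfl
  have hor : (fun t : L.Term (Fin n ⊕ Fin m) => t.realize (Sum.elim b c)) '' (or n m : Set _) =
      (fun t : L.Term A => t.realize id) ''
        ((fun t : L.Term (Fin n ⊕ Fin m) => t.subst fun i => Term.var (Sum.elim b c i)) ''
          (or n m : Set _)) := by
    rw [Set.image_image]
    simp [FirstOrder.Language.Term.realize_subst]
  have key : ∀ (T : Set (L.Term A)) (ρ : A → L.Term ℕ) (γ : L.Term ℕ), T.Finite → _ :=
    fun T ρ γ hT => h n m hn hm ((fun t : L.Term A => t.subst ρ) '' T) (hT.image _)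
      (fun i => ρ (b i)) (fun j => ρ (c j)) γ
  have hmem : ∀ (a : A) {p : ℕ} (d : Fin p → A), a ∈ (generate S (Set.range d)).carrier ↔
      ∃ T ⊆ kernel S A, T.Finite ∧
        S.UniformlyEntails (T ∪ Term.var '' Set.range d) (Term.var a) := by
    intro a p d
    simpa using forall_realize_mem_generate_iff hS (Set.finite_range d)
      (Set.finite_singleton (Term.var a : L.Term A))
  have himage : ∀ (T : Set (L.Term A)) (ρ : A → L.Term ℕ), (fun t : L.Term A => t.subst ρ) ''
      (T ∪ (fun t : L.Term (Fin n ⊕ Fin m) => t.subst fun i => Term.var (Sum.elim b c i)) ''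
          (or n m : Set _)) = (fun t : L.Term A => t.subst ρ) '' T ∪
        (fun t : L.Term (Fin n ⊕ Fin m) =>
          t.subst (Sum.elim (fun i => ρ (b i)) fun j => ρ (c j))) '' (or n m : Set _) := by
    intro T ρ
    rw [Set.image_union, Set.image_image]
    simp only [helim]
  ext a
  rw [Set.mem_inter_iff, hmem, hmem, hor]
  refine Iff.trans ?_ (realize_mem_generate_iff hS ((or n m).finite_toSet.image _)
    (Term.var a)).symm
  constructor
  · rintro ⟨⟨T, hT, hTfin, hTa⟩, ⟨U, hU, hUfin, hUa⟩⟩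
    -- Both cases must share their side premises, so the two kernel parts are merged.
    refine ⟨T ∪ U, Set.union_subset hT hU, hTfin.union hUfin, fun ρ => ?_⟩
    rw [himage]
    refine (key _ ρ _ (hTfin.union hUfin)).1 ⟨?_, ?_⟩
    · rw [← hvar]
      exact hTa.mono (Set.union_subset_union_left _ Set.subset_union_left) ρ
    · rw [← hvar]
      exact hUa.mono (Set.union_subset_union_left _ Set.subset_union_right) ρ
  · rintro ⟨T, hT, hTfin, hTa⟩
    refine ⟨⟨T, hT, hTfin, fun ρ => ?_⟩, ⟨T, hT, hTfin, fun ρ => ?_⟩⟩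
    · rw [hvar]
      refine ((key _ ρ _ hTfin).2 ?_).1
      rw [← himage]
      exact hTa ρ
    · rw [hvar]
      refine ((key _ ρ _ hTfin).2 ?_).2
      rw [← himage]
      exact hTa ρ

end DeductiveSystem
end AAL

/-! ### Values of formulas in semilattices, and the order on compact filters. -/

namespace AAL
open FirstOrder.Language (Term)
open DeductiveFilter

namespace IPCFormula

variable {T : Type w} [SemilatticeInf T]

theorem IsValue.unique {v : ℕ → T} {φ : IPCFormula} {a b : T} (ha : φ.IsValue v a)
    (hb : φ.IsValue v b) : a = b := by
  induction φ generalizing a b with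
  | var n => exact (show a = v n from ha).trans (show b = v n from hb).symm
  | and φ ψ ihφ ihψ =>
    obtain ⟨p, q, hp, hq, rfl⟩ := ha
    obtain ⟨p', q', hp', hq', rfl⟩ := hb
    rw [ihφ hp hp', ihψ hq hq']
  | or φ ψ ihφ ihψ =>
    obtain ⟨p, q, hp, hq, h⟩ := ha
    obtain ⟨p', q', hp', hq', h'⟩ := hb
    rw [ihφ hp hp', ihψ hq hq'] at h
    exact h.unique h'
  | imp φ ψ ihφ ihψ =>
    obtain ⟨p, q, hp, hq, h⟩ := ha
    obtain ⟨p', q', hp', hq', h'⟩ := hb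
    rw [ihφ hp hp', ihψ hq hq'] at h
    exact le_antisymm ((h' a).1 ((h a).2 le_rfl)) ((h b).1 ((h' b).2 le_rfl))
  | neg φ ihφ =>
    obtain ⟨p, z, hp, hz, h⟩ := ha
    obtain ⟨p', z', hp', hz', h'⟩ := hb
    rw [ihφ hp hp', le_antisymm (hz z') (hz' z)] at h
    exact le_antisymm ((h' a).1 ((h a).2 le_rfl)) ((h b).1 ((h' b).2 le_rfl))
  | zero => exact le_antisymm (ha b) (hb a)
  | one => exact le_antisymm (hb a) (ha b)

theorem isValue_of_subsingleton [Subsingleton T] (v : ℕ → T) (φ : IPCFormula) (a : T) :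
    φ.IsValue v a := by
  have hle : ∀ b c : T, b ≤ c := fun b c => (Subsingleton.elim b c).le
  induction φ generalizing a with
  | var n => exact Subsingleton.elim _ _
  | and φ ψ ihφ ihψ => exact ⟨a, a, ihφ a, ihψ a, Subsingleton.elim _ _⟩
  | or φ ψ ihφ ihψ =>
    exact ⟨a, a, ihφ a, ihψ a, fun _ _ => hle _ _, fun _ _ => hle _ _⟩
  | imp φ ψ ihφ ihψ =>
    exact ⟨a, a, ihφ a, ihψ a, fun _ => iff_of_true (hle _ _) (hle _ _)⟩
  | neg φ ihφ =>
    exact ⟨a, a, ihφ a, fun _ => hle _ _,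
      fun _ => iff_of_true (Subsingleton.elim _ _) (hle _ _)⟩
  | zero => exact fun _ => hle _ _
  | one => exact fun _ => hle _ _

/-- The variables of a formula are bounded. -/
theorem exists_occurs_lt (φ : IPCFormula) : ∃ N, ∀ x, φ.Occurs x → x < N := by
  have key : ∃ N, ∀ s x, φ.HasOcc s x → x < N := by
    induction φ with
    | var n => exact ⟨n + 1, fun s x h => h.2 ▸ Nat.lt_succ_self _⟩
    | and φ ψ ihφ ihψ | or φ ψ ihφ ihψ | imp φ ψ ihφ ihψ =>
      obtain ⟨M, hM⟩ := ihφ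
      obtain ⟨N, hN⟩ := ihψ
      exact ⟨max M N, fun s x h => h.elim (fun h => lt_max_of_lt_left (hM _ x h))
        fun h => lt_max_of_lt_right (hN _ x h)⟩
    | neg φ ihφ =>
      obtain ⟨M, hM⟩ := ihφ
      exact ⟨M, fun s x h => hM _ x h⟩
    | zero | one => exact ⟨0, fun s x h => h.elim⟩
  obtain ⟨N, hN⟩ := key
  exact ⟨N, fun x h => h.elim (hN _ x) (hN _ x)⟩

end IPCFormula

section CompactFilters

variable {L : FirstOrder.Language.{u, v}} {A : Type w} [L.Structure A]

/-- The compact deductive filter generated by a finite set. -/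
def generateCompact (S : DeductiveSystem L) (C : Set A) (hC : C.Finite) : CompactFilters S A :=
  OrderDual.toDual ⟨generate S C, isCompactElement_generate hC⟩

variable {S : DeductiveSystem L}

theorem exists_generateCompact (F : CompactFilters S A) :
    ∃ (C : Set A) (hC : C.Finite), F = generateCompact S C hC := by
  obtain ⟨C, hC, h⟩ := exists_finite_generate (OrderDual.ofDual F).2
  exact ⟨C, hC, Subtype.ext h⟩

theorem generateCompact_le_iff {C D : Set A} (hC : C.Finite) (hD : D.Finite) :
    generateCompact S C hC ≤ generateCompact S D hD ↔ D ⊆ (generate S C).carrier :=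
  generate_le_iff

theorem generateCompact_inf {C D : Set A} (hC : C.Finite) (hD : D.Finite) :
    generateCompact S C hC ⊓ generateCompact S D hD = generateCompact S (C ∪ D) (hC.union hD) :=
  Subtype.ext (generate_sup_generate C D)

theorem isBot_generateCompact {C : Set A} (hC : C.Finite)
    (h : (generate S C).carrier = Set.univ) : IsBot (generateCompact S C hC) := by
  intro F
  obtain ⟨D, hD, rfl⟩ := exists_generateCompact F
  rw [generateCompact_le_iff, h]
  exact Set.subset_univ D

theorem generateCompact_eq_iff {C D : Set A} (hC : C.Finite) (hD : D.Finite)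
    (h : (generate S C).carrier = Set.univ) :
    generateCompact S D hD = generateCompact S C hC ↔ (generate S D).carrier = Set.univ := by
  constructor
  · intro heq
    have : generate S D = generate S C := congrArg (fun F => (OrderDual.ofDual F).1) heq
    rw [this, h]
  · intro hD'
    exact le_antisymm (isBot_generateCompact hD hD' _) (isBot_generateCompact hC h _)

/-- If the variable `x₀` is a theorem, every filter is all of `A`. -/
theorem subsingleton_compactFilters [Nonempty A] (h : ∀ φ, S.Entails ∅ φ) :
    Subsingleton (CompactFilters S A) := by
  have huniv : ∀ F : DeductiveFilter S A, F.carrier = Set.univ := fun F =>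
    Set.eq_univ_of_forall fun a => F.realize_mem (h (Term.var 0)) (fun _ => a) (by simp)
  exact ⟨fun F G => Subtype.ext (carrier_injective ((huniv _).trans (huniv _).symm))⟩

end CompactFilters

/-! ### The sets `𝛗ᵏ` generate the values of formulas. -/

section Bold

variable {L : FirstOrder.Language.{u, v}} {S : DeductiveSystem L} (W : Witnesses S)

theorem range_enum {α : Type*} (X : Finset α) : Set.range (enum X) = X := by
  ext x
  constructor
  · rintro ⟨i, rfl⟩
    exact (X.equivFin.symm i).2
  · intro hx
    exact ⟨X.equivFin ⟨x, hx⟩, by simp [enum]⟩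

theorem Witnesses.entails_top (φ : L.Term ℕ) : S.Entails ∅ (W.top.subst fun _ => φ) := by
  have := S.subst (fun _ => φ) W.top_spec
  rw [Set.image_empty, subst_subst] at this
  exact this

variable {W}

/-- An empty `∼ₙ` would make a set of theorems inconsistent. -/
theorem Witnesses.neg_nonempty (hIL : S.HasIL) (htriv : ¬ ∀ φ, S.Entails ∅ φ) {n : ℕ}
    (hn : 0 < n) : (W.neg n).Nonempty := by
  rw [Finset.nonempty_iff_ne_empty]
  intro hempty
  refine htriv fun φ => S.cut ?_ ((W.neg_spec hIL n hn ∅ Set.finite_empty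
    fun _ => W.top.subst fun _ => Term.var 0).2 (by simp [hempty]) φ)
  rintro _ (h | ⟨_, rfl⟩)
  · exact h.elim
  · exact W.entails_top _

/-- An empty `⇒ₙₘ` would make every formula follow from a theorem. -/
theorem Witnesses.imp_nonempty (hDT : S.HasDT) (htriv : ¬ ∀ φ, S.Entails ∅ φ) {n m : ℕ}
    (hn : 0 < n) (hm : 0 < m) : (W.imp n m).Nonempty := by
  rw [Finset.nonempty_iff_ne_empty]
  intro hempty
  refine htriv fun φ => S.cut ?_ ((W.imp_spec hDT n m hn hm ∅ Set.finite_empty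
    (fun _ => W.top.subst fun _ => Term.var 0) fun _ => φ).2 (by simp [hempty]) ⟨0, hm⟩)
  rintro _ (h | ⟨_, rfl⟩)
  · exact h.elim
  · exact W.entails_top _

/-- An empty `⋎ₙₘ` would turn `φ ⊢ φ`, used in both cases, into `∅ ⊢ φ`. -/
theorem Witnesses.or_nonempty (hPC : S.HasPC) (htriv : ¬ ∀ φ, S.Entails ∅ φ) {n m : ℕ}
    (hn : 0 < n) (hm : 0 < m) : (W.or n m).Nonempty := by
  rw [Finset.nonempty_iff_ne_empty]
  intro hempty
  refine htriv fun φ => ?_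
  have := (W.or_spec hPC n m hn hm ∅ Set.finite_empty (fun _ => φ) (fun _ => φ) φ).1
    ⟨S.refl (Or.inr ⟨⟨0, hn⟩, rfl⟩), S.refl (Or.inr ⟨⟨0, hm⟩, rfl⟩)⟩
  simpa [hempty] using this

-- The metatheorems cover only positive arities, so the induction on values needs these sets to be
-- nonempty.
open Classical in
theorem IPCFormula.bold_nonempty (htriv : ¬ ∀ φ, S.Entails ∅ φ) {k : ℕ} (hk : 0 < k)
    (φ : IPCFormula) (hφ : φ.Compatible S) : (φ.bold W k).Nonempty := by
  induction φ with
  | var n => exact (Finset.nonempty_range_iff.2 hk.ne').image _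
  | and φ ψ ihφ ihψ =>
    exact (ihφ ⟨fun h => hφ.1 (Or.inl h), fun h => hφ.2.1 (Or.inl h),
      fun h => hφ.2.2 (Or.inl h)⟩).mono Finset.subset_union_left
  | or φ ψ ihφ ihψ =>
    exact (Witnesses.or_nonempty (hφ.2.2 trivial) htriv
      (Finset.card_pos.2 (ihφ ⟨fun h => hφ.1 (Or.inl h), fun h => hφ.2.1 (Or.inl h),
        fun _ => hφ.2.2 trivial⟩))
      (Finset.card_pos.2 (ihψ ⟨fun h => hφ.1 (Or.inr h), fun h => hφ.2.1 (Or.inr h),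
        fun _ => hφ.2.2 trivial⟩))).image _
  | imp φ ψ ihφ ihψ =>
    exact (Witnesses.imp_nonempty (hφ.2.1 trivial) htriv
      (Finset.card_pos.2 (ihφ ⟨fun h => hφ.1 (Or.inl h), fun _ => hφ.2.1 trivial,
        fun h => hφ.2.2 (Or.inl h)⟩))
      (Finset.card_pos.2 (ihψ ⟨fun h => hφ.1 (Or.inr h), fun _ => hφ.2.1 trivial,
        fun h => hφ.2.2 (Or.inr h)⟩))).image _
  | neg φ ihφ =>
    exact (Witnesses.neg_nonempty (hφ.1 trivial) htriv
      (Finset.card_pos.2 (ihφ ⟨fun _ => hφ.1 trivial, hφ.2.1, hφ.2.2⟩))).image _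
  | zero => exact (Finset.singleton_nonempty _).mono Finset.subset_union_left
  | one => exact Finset.singleton_nonempty _

variable {A : Type w} [L.Structure A]

/-- The values in `A` of the formulas in `𝛗ᵏ`. -/
def IPCFormula.boldValues (W : Witnesses S) (k : ℕ) (γ : ℕ × ℕ → A) (φ : IPCFormula) : Set A :=
  (fun t : L.Term (ℕ × ℕ) => t.realize γ) '' (φ.bold W k : Set (L.Term (ℕ × ℕ)))

theorem IPCFormula.finite_boldValues (k : ℕ) (γ : ℕ × ℕ → A) (φ : IPCFormula) :
    (φ.boldValues W k γ).Finite :=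
  (φ.bold W k).finite_toSet.image _

theorem IPCFormula.range_realize_enum (k : ℕ) (γ : ℕ × ℕ → A) (φ : IPCFormula) :
    Set.range (fun i => (enum (φ.bold W k) i).realize γ) = φ.boldValues W k γ := by
  rw [IPCFormula.boldValues, ← range_enum, ← Set.range_comp]
  rfl

theorem realize_subst_sumElim {α β δ : Type*} (t : L.Term (α ⊕ β)) (f : α → L.Term δ)
    (g : β → L.Term δ) (γ : δ → A) :
    (t.subst (Sum.elim f g)).realize γ =
      t.realize (Sum.elim (fun i => (f i).realize γ) fun j => (g j).realize γ) := by
  rw [FirstOrder.Language.Term.realize_subst]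
  congr 1
  funext i
  cases i <;> rfl

/-- In the semilattice of compact filters the value of `φ` is generated by the values of
the formulas in `𝛗ᵏ`. -/
theorem IPCFormula.isValue_generateCompact [Nonempty A] (hS : S.IsProtoalgebraic) {k : ℕ}
    (hk : 0 < k) (γ : ℕ × ℕ → A) (v : ℕ → CompactFilters S A) (φ : IPCFormula)
    (hφ : φ.Compatible S)
    (hv : ∀ i, φ.Occurs i → v i = generateCompact S ((fun j => γ (i, j)) '' Set.Iio k)
      ((Set.finite_Iio k).image _)) :
    φ.IsValue v (generateCompact S (φ.boldValues W k γ) (φ.finite_boldValues k γ)) := by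
  -- In the trivial logic `𝛗ᵏ` may be empty, but then the semilattice has one element.
  by_cases htriv : ∀ φ, S.Entails ∅ φ
  · have := subsingleton_compactFilters (A := A) htriv
    exact isValue_of_subsingleton _ _ _
  have hpos : ∀ ψ : IPCFormula, ψ.Compatible S → 0 < (ψ.bold W k).card := fun ψ hψ =>
    Finset.card_pos.2 (ψ.bold_nonempty htriv hk hψ)
  induction φ with
  | var n =>
    change _ = v n
    rw [hv n (Or.inl ⟨rfl, rfl⟩)]
    congr 1
    simp only [boldValues, bold, Finset.coe_image, Finset.coe_range, Set.image_image]
    rfl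
  | and φ ψ ihφ ihψ =>
    refine ⟨_, _, ihφ ⟨fun h => hφ.1 (Or.inl h), fun h => hφ.2.1 (Or.inl h),
      fun h => hφ.2.2 (Or.inl h)⟩ fun i hi => hv i (hi.imp Or.inl Or.inl),
      ihψ ⟨fun h => hφ.1 (Or.inr h), fun h => hφ.2.1 (Or.inr h),
      fun h => hφ.2.2 (Or.inr h)⟩ fun i hi => hv i (hi.imp Or.inr Or.inr), ?_⟩
    rw [generateCompact_inf]
    congr 1
    simp [boldValues, bold, Set.image_union]
  | or φ ψ ihφ ihψ =>
    have hcφ : φ.Compatible S :=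
      ⟨fun h => hφ.1 (Or.inl h), fun h => hφ.2.1 (Or.inl h), fun _ => hφ.2.2 trivial⟩
    have hcψ : ψ.Compatible S :=
      ⟨fun h => hφ.1 (Or.inr h), fun h => hφ.2.1 (Or.inr h), fun _ => hφ.2.2 trivial⟩
    refine ⟨_, _, ihφ hcφ fun i hi => hv i (hi.imp Or.inl Or.inl),
      ihψ hcψ fun i hi => hv i (hi.imp Or.inr Or.inr), ?_⟩
    have hinter := (W.or_spec (hφ.2.2 trivial)).generate_inter hS (hpos φ hcφ) (hpos ψ hcψ)
      (fun i => (enum (φ.bold W k) i).realize γ) (fun i => (enum (ψ.bold W k) i).realize γ)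
    rw [range_realize_enum, range_realize_enum] at hinter
    have hor : (φ.or ψ).boldValues W k γ =
        (fun t : L.Term _ => t.realize (Sum.elim (fun i => (enum (φ.bold W k) i).realize γ)
          fun i => (enum (ψ.bold W k) i).realize γ)) ''
          (W.or (φ.bold W k).card (ψ.bold W k).card : Set _) := by
      simp only [boldValues, bold, Finset.coe_image, Set.image_image, realize_subst_sumElim]
    rw [← hor] at hinter
    constructor
    · rintro _ (rfl | rfl)
      · rw [generateCompact_le_iff]
        exact (subset_generate _).trans (hinter.symm.subset.trans Set.inter_subset_left)
      · rw [generateCompact_le_iff]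
        exact (subset_generate _).trans (hinter.symm.subset.trans Set.inter_subset_right)
    · intro F hF
      obtain ⟨D, hD, rfl⟩ := exists_generateCompact F
      have h1 := hF (Or.inl rfl)
      have h2 := hF (Or.inr rfl)
      rw [generateCompact_le_iff] at h1 h2 ⊢
      rw [← hinter]
      exact Set.subset_inter h1 h2
  | imp φ ψ ihφ ihψ =>
    have hcφ : φ.Compatible S :=
      ⟨fun h => hφ.1 (Or.inl h), fun _ => hφ.2.1 trivial, fun h => hφ.2.2 (Or.inl h)⟩
    have hcψ : ψ.Compatible S :=
      ⟨fun h => hφ.1 (Or.inr h), fun _ => hφ.2.1 trivial, fun h => hφ.2.2 (Or.inr h)⟩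
    refine ⟨_, _, ihφ hcφ fun i hi => hv i (hi.elim (fun h => Or.inr (Or.inl h))
        fun h => Or.inl (Or.inl h)),
      ihψ hcψ fun i hi => hv i (hi.imp Or.inr Or.inr), fun F => ?_⟩
    obtain ⟨D, hD, rfl⟩ := exists_generateCompact F
    have hmem := (W.imp_spec (hφ.2.1 trivial)).mem_generate_iff hS (hpos φ hcφ) (hpos ψ hcψ) hD
      (fun i => (enum (φ.bold W k) i).realize γ) (fun i => (enum (ψ.bold W k) i).realize γ)
    rw [range_realize_enum] at hmem
    rw [generateCompact_inf, generateCompact_le_iff, generateCompact_le_iff,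
      ← range_realize_enum (φ := ψ), Set.range_subset_iff, hmem]
    simp only [boldValues, bold, Finset.coe_image, Set.image_image, Set.image_subset_iff,
      realize_subst_sumElim]
    rfl
  | neg φ ihφ =>
    have hcφ : φ.Compatible S := ⟨fun _ => hφ.1 trivial, hφ.2.1, hφ.2.2⟩
    have hIL := W.neg_spec (hφ.1 trivial)
    -- The improper filter is compact, which provides the minimum required by the pseudocomplement.
    have huniv := hIL.generate_eq_univ (Classical.arbitrary A)
    refine ⟨_, generateCompact S _ ((Set.finite_singleton (Classical.arbitrary A)).union
      ((W.neg 1).finite_toSet.image _)), ihφ hcφ fun i hi => hv i hi.symm,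
      isBot_generateCompact _ huniv, fun F => ?_⟩
    obtain ⟨D, hD, rfl⟩ := exists_generateCompact F
    have hiff := hIL.generate_eq_univ_iff hS (hpos φ hcφ) hD
      (fun i => (enum (φ.bold W k) i).realize γ)
    rw [range_realize_enum] at hiff
    rw [generateCompact_inf, generateCompact_eq_iff _ _ huniv, generateCompact_le_iff, hiff]
    simp only [boldValues, bold, Finset.coe_image, Set.image_image, Set.image_subset_iff,
      FirstOrder.Language.Term.realize_subst]
    rfl
  | zero =>
    refine isBot_generateCompact _ ?_
    have := (W.neg_spec (hφ.1 trivial)).generate_eq_univ (γ (0, 0))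
    simpa [boldValues, bold, Set.image_image, Set.image_insert_eq,
      FirstOrder.Language.Term.realize_subst] using this
  | one =>
    intro F
    obtain ⟨D, hD, rfl⟩ := exists_generateCompact F
    rw [generateCompact_le_iff]
    rintro _ ⟨t, ht, rfl⟩
    obtain rfl : t = _ := by simpa [bold] using ht
    have := (generate S D).realize_mem W.top_spec (fun _ => γ (0, 0)) (by simp)
    rw [FirstOrder.Language.Term.realize_subst] at this
    change (W.top.subst _).realize γ ∈ (generate S D).carrier
    rwa [FirstOrder.Language.Term.realize_subst]

end Bold
end AAL

/-! ### Existence of values and the equivalence of the three conditions. -/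

namespace AAL
open FirstOrder.Language (Term)
open DeductiveFilter DeductiveSystem

/-- An enumeration with repetitions exhausts `C` after finitely many steps; allowing all larger `k`
lets several sets share one length. -/
theorem exists_image_Iio_eq {α : Type*} {C : Set α} (hC : C.Finite) (hne : C.Nonempty) :
    ∃ (g : ℕ → α) (n : ℕ), ∀ k, n ≤ k → g '' Set.Iio k = C := by
  have := hC.countable.to_subtype
  have := hne.to_subtype
  obtain ⟨g, hg⟩ := exists_surjective_nat C
  choose r hr using hg
  have := hC.to_subtype
  obtain ⟨n, hn⟩ := (Set.finite_range r).bddAbove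
  refine ⟨fun j => g j, n + 1, fun k hk => Set.Subset.antisymm ?_ fun c hc => ?_⟩
  · rintro _ ⟨j, _, rfl⟩
    exact (g j).2
  · exact ⟨r ⟨c, hc⟩, lt_of_lt_of_le (Nat.lt_succ_of_le (hn ⟨_, rfl⟩)) hk, by simp [hr]⟩

variable {L : FirstOrder.Language.{u, v}} {S : DeductiveSystem L} {A : Type w} [L.Structure A]

/-- Finitely many compact filters have generating sets of the same positive size. -/
theorem exists_uniform_generators [Nonempty A] (W : Witnesses S) (f : ℕ → CompactFilters S A)
    (N : ℕ) : ∃ (k : ℕ) (γ : ℕ × ℕ → A), 0 < k ∧ ∀ i < N, f i =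
      generateCompact S ((fun j => γ (i, j)) '' Set.Iio k) ((Set.finite_Iio k).image _) := by
  have key : ∀ i, ∃ (g : ℕ → A) (n : ℕ), ∀ k, n ≤ k →
      f i = generateCompact S (g '' Set.Iio k) ((Set.finite_Iio k).image _) := by
    intro i
    obtain ⟨C, hC, hf⟩ := exists_generateCompact (f i)
    -- The value of a theorem lies in every filter, so adjoining it makes the generating set
    -- nonempty without changing the filter.
    let a : A := W.top.realize fun _ => Classical.arbitrary A
    have ha : ∀ F : DeductiveFilter S A, a ∈ F.carrier := fun F => by
      have := F.realize_mem W.top_spec (fun _ => Classical.arbitrary A) (by simp)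
      rwa [FirstOrder.Language.Term.realize_subst] at this
    obtain ⟨g, n, hg⟩ := exists_image_Iio_eq (hC.insert a) (Set.insert_nonempty a C)
    refine ⟨g, n, fun k hk => hf.trans (Subtype.ext ?_)⟩
    change generate S C = generate S (g '' Set.Iio k)
    rw [hg k hk]
    exact le_antisymm (generate_mono (Set.subset_insert a C))
      (generate_le_iff.2 (Set.insert_subset (ha _) (subset_generate C)))
  choose g n hgn using key
  exact ⟨(Finset.range N).sup n + 1, fun p => g p.1 p.2, Nat.succ_pos _, fun i hi =>
    hgn i _ ((Finset.le_sup (Finset.mem_range.2 hi)).trans (Nat.le_succ _))⟩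

theorem IPCFormula.existsUnique_isValue [Nonempty A] (hS : S.IsProtoalgebraic) (W : Witnesses S)
    (φ : IPCFormula) (hφ : φ.Compatible S) (f : ℕ → CompactFilters S A) :
    ∃! a, φ.IsValue f a := by
  obtain ⟨N, hN⟩ := φ.exists_occurs_lt
  obtain ⟨k, γ, hk, hγ⟩ := exists_uniform_generators W f N
  have := φ.isValue_generateCompact (W := W) hS hk γ f hφ fun i hi => hγ i (hN i hi)
  exact ⟨_, this, fun b hb => hb.unique this⟩

/-- The filters of an isomorphic copy of the algebra of formulas are theories. -/
theorem mem_generate_iff_entails (e : L.Equiv A (L.Term ℕ)) (C : Set A) (a : A) :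
    a ∈ (generate S C).carrier ↔ S.Entails (e '' C) (e a) := by
  constructor
  · let F : DeductiveFilter S A :=
      { carrier := {a | S.Entails (e '' C) (e a)}
        closed := fun Γ φ h f hf => by
          have hsub : ∀ t, e (f t) = t.subst fun n => e (f (Term.var n)) := by
            intro t
            rw [← realize_term_eq_subst]
            exact hom_eq_realize (e.toHom.comp f) t
          change S.Entails (e '' C) (e (f φ))
          rw [hsub]
          refine S.cut ?_ (S.subst _ h)
          rintro _ ⟨t, ht, rfl⟩
          have : S.Entails (e '' C) (e (f t)) := hf ⟨t, ht, rfl⟩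
          rwa [hsub] at this }
    intro h
    have hle : generate S C ≤ F := generate_le_iff.2 fun c hc => S.refl ⟨c, hc, rfl⟩
    exact hle h
  · intro h
    have := (generate S C).closed _ _ h e.symm.toHom (by
      rintro _ ⟨_, ⟨c, hc, rfl⟩, rfl⟩
      simpa using subset_generate C hc)
    simpa using this

namespace SahlqvistQuasiequation

variable {Φ : SahlqvistQuasiequation}

theorem validIn_of_validates [Nonempty A] (hS : S.IsProtoalgebraic) (hΦ : Φ.Compatible S)
    (W : Witnesses S) (h : ∀ r ∈ Φ.metarules W, S.Validates r) :
    Φ.ValidIn (CompactFilters S A) := by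
  intro f
  have hbound : ∃ N, ∀ l x, (Φ.φ l).Occurs x → x < N := by
    choose n hn using fun l => (Φ.φ l).exists_occurs_lt
    exact ⟨Finset.univ.sup n, fun l x hx =>
      (hn l x hx).trans_le (Finset.le_sup (Finset.mem_univ l))⟩
  obtain ⟨N, hN⟩ := hbound
  obtain ⟨k, γ, hk, hγ⟩ := exists_uniform_generators W f N
  refine ⟨fun l => generateCompact S ((Φ.φ l).boldValues W k γ)
    ((Φ.φ l).finite_boldValues k γ), fun l =>
    (Φ.φ l).isValue_generateCompact hS hk γ f (hΦ l) fun i hi => hγ i (hN l i hi), ?_⟩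
  obtain ⟨Y, hY, hfY⟩ := exists_generateCompact (f Φ.y)
  obtain ⟨Z, hZ, hfZ⟩ := exists_generateCompact (f Φ.z)
  rw [hfY, hfZ]
  intro hle
  rw [generateCompact_le_iff]
  intro z hz
  let Γ : Fin Φ.m → Set (L.Term A) := fun l => Term.var '' Y ∪
    (fun t : L.Term (ℕ × ℕ) => t.subst fun p => Term.var (γ p)) '' ((Φ.φ l).bold W k : Set _)
  have hΓfin : ∀ l, (Γ l).Finite := fun l =>
    (hY.image _).union (((Φ.φ l).bold W k).finite_toSet.image _)
  have hΓ : ∀ l, (fun t : L.Term A => t.realize id) '' Γ l =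
      (Φ.φ l).boldValues W k γ ∪ Y := by
    intro l
    rw [Set.image_union, Set.image_image, Set.image_image, Set.union_comm]
    simp [IPCFormula.boldValues, FirstOrder.Language.Term.realize_subst]
  have hprem : ∀ l ∈ (Set.univ : Set (Fin Φ.m)), S.KernelEntails (Γ l) (Term.var z) := by
    intro l _
    rw [← realize_mem_generate_iff hS (hΓfin l), hΓ]
    have := hle l
    rw [generateCompact_inf, generateCompact_le_iff] at this
    exact this hz
  -- All premises of a metarule share the same `Γ`, hence one `T` for all `l`.
  obtain ⟨T, hT, hTfin, hTΓ⟩ := exists_common_kernel Set.finite_univ hprem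
  have hY' : Y = (fun t : L.Term A => t.realize id) '' (Term.var '' Y) := by
    rw [Set.image_image]; simp
  rw [hY']
  refine (realize_mem_generate_iff hS (hY.image _) (Term.var z)).2 ⟨T, hT, hTfin, fun ρ => ?_⟩
  refine h ⟨_, _⟩ ⟨k, (fun t : L.Term A => t.subst ρ) '' (T ∪ Term.var '' Y),
    ρ z, fun p => ρ (γ p), hk, (hTfin.union (hY.image _)).image _, rfl, rfl⟩ ?_
  rintro _ ⟨l, rfl⟩
  have := hTΓ l trivial ρ
  rw [← Set.union_assoc, Set.image_union _ (T ∪ _), Set.image_image] at this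
  simp only [subst_subst] at this
  exact this

/-- Stating this for an isomorphic copy of the algebra of formulas covers both `CompactTheories S`
and a copy lifted to another universe. -/
theorem validates_of_validIn [Nonempty A] (hS : S.IsProtoalgebraic) (hΦ : Φ.Compatible S)
    (W : Witnesses S) (e : L.Equiv A (L.Term ℕ)) (h : Φ.ValidIn (CompactFilters S A)) :
    ∀ r ∈ Φ.metarules W, S.Validates r := by
  rintro ⟨P, c⟩ ⟨k, Γ, ψ, γ, hk, hΓ, hP, hc⟩
  dsimp only at hP hc
  subst hP hc
  intro hprem
  let γ' : ℕ × ℕ → A := fun p => e.symm (γ p)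
  -- Send `y` to the theory of `Γ`, `z` to that of `ψ`, and `xᵢ` to that of the `γᵢʲ`. As `y` and
  -- `z` occur in no `φₗ`, the first two choices do not disturb the values of the `φₗ`.
  let f : ℕ → CompactFilters S A := fun i =>
    if i = Φ.y then generateCompact S (e.symm '' Γ) (hΓ.image _)
    else if i = Φ.z then generateCompact S {e.symm ψ} (Set.finite_singleton _)
    else generateCompact S ((fun j => γ' (i, j)) '' Set.Iio k) ((Set.finite_Iio k).image _)
  have hfy : f Φ.y = generateCompact S (e.symm '' Γ) (hΓ.image _) := if_pos rfl
  have hfz : f Φ.z = generateCompact S {e.symm ψ} (Set.finite_singleton _) :=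
    (if_neg Φ.y_ne_z.symm).trans (if_pos rfl)
  obtain ⟨a, ha, himp⟩ := h f
  have hval : ∀ l, a l = generateCompact S ((Φ.φ l).boldValues W k γ')
      ((Φ.φ l).finite_boldValues k γ') := by
    intro l
    refine (ha l).unique ((Φ.φ l).isValue_generateCompact hS hk γ' f (hΦ l) fun i hi => ?_)
    have hy : i ≠ Φ.y := fun hiy => Φ.y_not_occurs l (hiy ▸ hi)
    have hz : i ≠ Φ.z := fun hiz => Φ.z_not_occurs l (hiz ▸ hi)
    exact (if_neg hy).trans (if_neg hz)
  have hΓe : e '' (e.symm '' Γ) = Γ := by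
    rw [Set.image_image]; simp
  rw [hfy, hfz, generateCompact_le_iff, Set.singleton_subset_iff, mem_generate_iff_entails e,
    hΓe, e.apply_symm_apply] at himp
  refine himp fun l => ?_
  rw [hval, generateCompact_inf, generateCompact_le_iff, Set.singleton_subset_iff,
    mem_generate_iff_entails e, Set.image_union, hΓe, e.apply_symm_apply, Set.union_comm]
  have hbold : e '' (Φ.φ l).boldValues W k γ' =
      (fun t : L.Term (ℕ × ℕ) => t.subst γ) '' ((Φ.φ l).bold W k : Set _) := by
    rw [IPCFormula.boldValues, Set.image_image]
    refine Set.image_congr fun t _ => ?_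
    refine (hom_eq_realize (e.toHom.comp (evalHom γ')) t).trans ?_
    rw [← realize_term_eq_subst]
    congr 1
    funext p
    exact e.apply_symm_apply (γ p)
  rw [hbold]
  exact hprem _ ⟨l, rfl⟩

end SahlqvistQuasiequation

end AAL

theorem mainTheorem7 {L : FirstOrder.Language.{u, v}} [L.IsAlgebraic]
    (S : AAL.DeductiveSystem L) (hS : S.IsProtoalgebraic)
    (Φ : AAL.SahlqvistQuasiequation) (hΦ : Φ.Compatible S) (W : AAL.Witnesses S) :
    (∀ (A : Type (max u w)) [L.Structure A] [Nonempty A],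
      ∀ (i : Fin Φ.m) (f : ℕ → AAL.CompactFilters S A), ∃! a, (Φ.φ i).IsValue f a) ∧
    List.TFAE [
      ∀ r ∈ Φ.metarules W, S.Validates r,
      Φ.ValidIn (AAL.CompactTheories S),
      ∀ (A : Type (max u w)) [L.Structure A] [Nonempty A],
        Φ.ValidIn (AAL.CompactFilters S A)] := by
  refine ⟨fun A _ _ i f => (Φ.φ i).existsUnique_isValue hS W (hΦ i) f, ?_⟩
  have : Nonempty (L.Term ℕ) := ⟨FirstOrder.Language.Term.var 0⟩
  tfae_have 1 → 3 := fun h A _ _ => Φ.validIn_of_validates hS hΦ W h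
  tfae_have 1 → 2 := fun h => Φ.validIn_of_validates hS hΦ W h
  tfae_have 2 → 1 := fun h =>
    Φ.validates_of_validIn hS hΦ W (FirstOrder.Language.Equiv.refl L _) h
  tfae_have 3 → 1 := fun h => by
    -- The third condition quantifies over algebras in `Type (max u w)`, so the algebra of formulas
    -- is first lifted there.
    let e : L.Term ℕ ≃ ULift.{w} (L.Term ℕ) := Equiv.ulift.symm
    let _ : L.Structure (ULift.{w} (L.Term ℕ)) := e.inducedStructure
    exact Φ.validates_of_validIn hS hΦ W e.inducedStructureEquiv.symm (h _)
  tfae_finish
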